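/- Let $L'$ be a first-order language and let $\mathcal N$ be an infinite, locally finite $L'$-structure (every finite subset generates a finite substructure). Let $\mathrm{Age}(\mathcal N)$ be the class of finitely generated $L'$-structures that embed into $\mathcal N$. Then the following are equivalent: 1. $\mathrm{Age}(\mathcal N)$ is a Ramsey class, i.e. an isomorphism-closed class of finite structures with the hereditary property, the joint embedding property and the embedding Ramsey property. 2. $\mathcal N$ has the embedding Ramsey property: for all $A,B\in\mathrm{Age}(\mathcal N)$ such that $A$ embeds into $B$ there is $C\in\mathrm{Age}(\mathcal N)$ such that for every colouring $\chi$ of the embeddings $A\to C$ with two colours there is an embedding $f:B\to C$ for which $\chi(f\circ g)$ does not depend on the embedding $g:A\to B$. 3. $\mathcal N$-indexed indiscernibles have the modelling property: for every first-order language $L$, every complete $L$-theory $T$ with infinite models, every $\kappa$-saturated and $\kappa$-homogeneous model $\mathbb M$ of $T$ with $\kappa>|L|,|\mathcal N|$, and every sequence $\mathcal I=(\bar a_i:i\in\mathcal N)$ of tuples from $\mathbb M$ of the same length $<\kappa$, there is a sequence $\mathcal J=(\bar b_i:i\in\mathcal N)$ of tuples of that length from $\mathbb M$ such that * $\mathcal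 J$ is $\mathcal N$-indiscernible: for all $n$ and all $n$-tuples $(i_1,\dots,i_n)$, $(j_1,\dots,j_n)$ from $\mathcal N$ with the same quantifier-free type in $\mathcal N$, the tuples $(\bar b_{i_1},\dots,\bar b_{i_n})$ and $(\bar b_{j_1},\dots,\bar b_{j_n})$ have the same type in $\mathbb M$; * $\mathcal J$ is based on $\mathcal I$: for every finite set $\Delta$ of $L$-formulas, every $n$ and all $i_1,\dots,i_n$ from $\mathcal N$ there are $j_1,\dots,j_n$ from $\mathcal N$ such that $(i_1,\dots,i_n)$ and $(j_1,\dots,j_n)$ have the same quantifier-free type in $\mathcal N$ and $(\bar b_{i_1},\dots,\bar b_{i_n})$ and $(\bar a_{j_1},\dots,\bar a_{j_n})$ satisfy the same formulas of $\Delta$ in $\mathbb M$. 4. The same as 3, with sequences of finite tuples only. -/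

import Mathlib

universe u v u' v' w x y z

namespace GenIndisc

/-! ### Ramsey classes -/

section Ramsey

open scoped FirstOrder

variable {L' : FirstOrder.Language.{u', v'}}

/-- The partition arrow `C ⟶ (B)^A_r` for embeddings: every colouring of the embeddings of `A` into
`C` with `r` colours is constant on the embeddings of `A` into some copy of `B` in `C`. -/
def Arrows (A : Type x) (B : Type y) (C : Type z)
    [L'.Structure A] [L'.Structure B] [L'.Structure C] (r : ℕ) : Prop :=
  ∀ χ : (A ↪[L'] C) → Fin r, ∃ f : B ↪[L'] C, ∀ g h : A ↪[L'] B, χ (f.comp g) = χ (f.comp h)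

/-- The Embedding Ramsey Property of a class of structures. -/
def HasERP (K : Set (CategoryTheory.Bundled.{w} L'.Structure)) : Prop :=
  ∀ A ∈ K, ∀ B ∈ K, Nonempty (A ↪[L'] B) → ∃ C ∈ K, Arrows (L' := L') A B C 2

/-- A Ramsey class: an isomorphism-closed class of finite structures with HP, JEP and ERP. (All
substructures of a finite structure are finitely generated, so the notion `FirstOrder.Language.Hereditary` of
Mathlib is closure under arbitrary substructures here.) -/
structure IsRamseyClass (K : Set (CategoryTheory.Bundled.{w} L'.Structure)) : Prop where
  finite : ∀ A ∈ K, Finite A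
  iso_closed : ∀ A B : CategoryTheory.Bundled.{w} L'.Structure,
    Nonempty (A ≃[L'] B) → A ∈ K → B ∈ K
  hereditary : FirstOrder.Language.Hereditary K
  jointEmbedding : FirstOrder.Language.JointEmbedding K
  erp : HasERP K

/-- Every finite subset generates a finite substructure. -/
def IsLocallyFinite (L' : FirstOrder.Language.{u', v'}) (N : Type w) [L'.Structure N] : Prop :=
  ∀ S : Set N, S.Finite → (FirstOrder.Language.Substructure.closure L' S : Set N).Finite

end Ramsey

/-! ### Types -/

section Types

variable (L : FirstOrder.Language.{u, v}) {M : Type x} [L.Structure M] {β : Type y}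

/-- The complete type over `∅` of a tuple. -/
def tp (a : β → M) : Set (L.Formula β) :=
  {φ | φ.Realize a}

/-- The quantifier-free type over `∅` of a tuple. -/
def qftp (a : β → M) : Set (L.Formula β) :=
  {φ | φ ∈ tp L a ∧ φ.IsQF}

/-- The restriction of the type of a tuple to a set `Δ` of formulas (and their negations). -/
def deltaTp (Δ : Set (L.Formula β)) (a : β → M) : Set (L.Formula β) :=
  {φ | φ ∈ tp L a ∧ (φ ∈ Δ ∨ φ.not ∈ Δ)}

end Types

/-! ### Saturated and homogeneous models -/

section Monster

variable (L : FirstOrder.Language.{u, v}) (M : Type x) [L.Structure M]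

/-- `κ`-saturation: every partial type in one variable over fewer than `κ` parameters which is
finitely satisfiable in `M` is realised in `M`. The variables of a formula are the parameters `A`
together with one more variable. -/
def IsSaturated (κ : Cardinal.{x}) : Prop :=
  ∀ A : Set M, Cardinal.mk A < κ → ∀ p : Set (L.Formula (A ⊕ Unit)),
    (∀ p₀ ⊆ p, p₀.Finite → ∃ b : M, ∀ φ ∈ p₀,
      φ.Realize (Sum.elim (fun a : A => (a : M)) fun _ => b)) →
    ∃ b : M, ∀ φ ∈ p, φ.Realize (Sum.elim (fun a : A => (a : M)) fun _ => b)

/-- `κ`-homogeneity: every partial elementary map defined on fewer than `κ` elements can be extended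
to any further element. -/
def IsHomogeneous (κ : Cardinal.{x}) : Prop :=
  ∀ A : Set M, Cardinal.mk A < κ → ∀ f : A → M,
    tp L (fun a : A => (a : M)) = tp L f →
    ∀ c : M, ∃ d : M,
      tp L (Sum.elim (fun a : A => (a : M)) fun _ : Unit => c) = tp L (Sum.elim f fun _ : Unit => d)

end Monster

/-! ### Generalised indiscernibles and the modelling property -/

section Indiscernibles

variable (L' : FirstOrder.Language.{u', v'}) (N : Type w) [L'.Structure N]

/-- `(a_i : i ∈ N)`, a sequence of tuples of length `α`, is `N`-indiscernible. The concatenation of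
`a_{i_1}, …, a_{i_n}` is the tuple with index set `Fin n × α`. -/
def IsIndiscernible (L : FirstOrder.Language.{u, v}) {M : Type x} [L.Structure M] {α : Type y}
    (a : N → α → M) : Prop :=
  ∀ (n : ℕ) (i j : Fin n → N), qftp L' i = qftp L' j →
    tp L (fun k : Fin n × α => a (i k.1) k.2) = tp L (fun k : Fin n × α => a (j k.1) k.2)

/-- The sequence `b` is (locally) based on the sequence `a`. -/
def IsBasedOn (L : FirstOrder.Language.{u, v}) {M : Type x} [L.Structure M] {α : Type y}
    (b a : N → α → M) : Prop :=
  ∀ (n : ℕ) (Δ : Set (L.Formula (Fin n × α))), Δ.Finite → ∀ i : Fin n → N,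
    ∃ j : Fin n → N, qftp L' i = qftp L' j ∧
      deltaTp L Δ (fun k : Fin n × α => b (i k.1) k.2) =
        deltaTp L Δ (fun k : Fin n × α => a (j k.1) k.2)

/-- Every `N`-indexed sequence of tuples of length `α` from `M` admits an `N`-indiscernible sequence
in `M` that is based on it. -/
def ModelsSequences (L : FirstOrder.Language.{u, v}) (M : Type x) [L.Structure M] (α : Type y) : Prop :=
  ∀ a : N → α → M, ∃ b : N → α → M, IsIndiscernible L' N L b ∧ IsBasedOn L' N L b a

/-- `M` is a monster model of `T` with saturation cardinal `κ`, large enough to deal with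
`N`-indexed sequences. -/
structure IsMonster {L : FirstOrder.Language.{u, v}} (T : L.Theory) (M : Type (max u v w)) [L.Structure M]
    (κ : Cardinal.{max u v w}) : Prop where
  models : T.Model M
  card_language_lt : Cardinal.lift.{w} L.card < κ
  card_index_lt : Cardinal.lift.{max u v} (Cardinal.mk N) < κ
  saturated : IsSaturated L M κ
  homogeneous : IsHomogeneous L M κ

/-- The modelling property of `N` in `T`, for sequences of tuples of any small length. -/
def HasMPIn {L : FirstOrder.Language.{u, v}} (T : L.Theory) : Prop :=
  ∀ (κ : Cardinal.{max u v w}) (M : Type (max u v w)) [L.Structure M], IsMonster N T M κ →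
    ∀ α : Type (max u v w), Cardinal.mk α < κ → ModelsSequences L' N L M α

/-- The modelling property of `N` in `T`, for sequences of finite tuples only. -/
def HasFiniteMPIn {L : FirstOrder.Language.{u, v}} (T : L.Theory) : Prop :=
  ∀ (κ : Cardinal.{max u v w}) (M : Type (max u v w)) [L.Structure M], IsMonster N T M κ →
    ∀ m : ℕ, ModelsSequences L' N L M (Fin m)

/-- `N`-indexed indiscernibles have the modelling property: they have it in every complete theory
with infinite models. -/
def HasMP : Prop :=
  ∀ (L : FirstOrder.Language.{u, v}) (T : L.Theory), T.IsComplete →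
    (∃ M : FirstOrder.Language.Theory.ModelType.{u, v, max u v} T, Infinite M) → HasMPIn L' N T

/-- The modelling property restricted to sequences of finite tuples. -/
def HasFiniteMP : Prop :=
  ∀ (L : FirstOrder.Language.{u, v}) (T : L.Theory), T.IsComplete →
    (∃ M : FirstOrder.Language.Theory.ModelType.{u, v, max u v} T, Infinite M) → HasFiniteMPIn L' N T

end Indiscernibles

end GenIndisc

/-!
The equivalence of the first two statements only uses that the age of any structure is hereditary
and has the joint embedding property, and that its members are finite by local finiteness.
The equivalence with the modelling properties rests on the
fact that two tuples have the same quantifier-free type exactly if one is carried to the other by an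
isomorphism of the substructures they generate (`exists_embedding_of_qftp_eq`), so that a colouring
of the tuples of a fixed quantifier-free type is a colouring of the copies of a finitely generated
structure.

From the Ramsey property to the modelling property: given a sequence `a`, finitely many formulas and
a finite subset `S` of `N`, repeated use of the Ramsey property moves `S` to a copy on which `a` is
indiscernible for these formulas (`HasERP.exists_approximation`). On a tuple from `S`, the
resulting sequence takes the values of `a` at a tuple of the same quantifier-free type. The limit
type of these sequences along an ultrafilter is the type of an indiscernible sequence based on `a`,
and it is realised in every sufficiently saturated model
(`IsSaturated.exists_realize_ultrafilter`).

From the modelling property for single elements to the Ramsey property: if the Ramsey property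
failed for `A` and `B`, then a limit of bad colourings of the finitely generated substructures of
`N` would be a colouring of the copies of `A` in `N` that is not constant on any copy of `B`. The
coloured copies are the edges of a hypergraph on `N` of arity `|A|`. An indiscernible sequence based
on its vertices shows that some copy of `B` is homogeneous after all
(`HasFiniteMP.exists_homogeneous`). The modelling property has to be applied in a saturated and
homogeneous model that contains this hypergraph. Such a model is given explicitly as a
type of trees, `GenericHypergraph`: each new vertex comes with a family of earlier vertices and with
prescribed edges to them. Any small set of edge conditions on a new vertex is satisfiable in it, and
a back-and-forth argument shows that types are determined by atomic types, which yields saturation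
and homogeneity.
-/

namespace GenIndisc

open FirstOrder FirstOrder.Language Filter

/-! ### Quantifier-free types and embeddings -/

section QuantifierFree

variable {L : FirstOrder.Language.{u, v}} {P : Type x} {Q : Type y} [L.Structure P] [L.Structure Q]
  {β : Type z}

theorem realize_isQF_embedding (f : P ↪[L] Q) {n : ℕ} {φ : L.BoundedFormula β n} (hφ : φ.IsQF)
    (v : β → P) (xs : Fin n → P) : φ.Realize (f ∘ v) (f ∘ xs) ↔ φ.Realize v xs := by
  induction hφ with
  | falsum => rfl
  | of_isAtomic h =>
    cases h with
    | equal t₁ t₂ =>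
      simp only [BoundedFormula.realize_bdEqual, ← Sum.comp_elim, HomClass.realize_term]
      exact f.injective.eq_iff
    | rel R ts =>
      simp only [BoundedFormula.realize_rel, ← Sum.comp_elim, HomClass.realize_term]
      exact f.map_rel R _
  | imp _ _ h₁ h₂ => simp only [BoundedFormula.realize_imp, h₁, h₂]

theorem qftp_comp_embedding (f : P ↪[L] Q) (i : β → P) : qftp L (f ∘ i) = qftp L i := by
  ext φ
  refine and_congr_left fun h => ?_
  have := realize_isQF_embedding f h i default
  rwa [Subsingleton.elim (f ∘ default) default] at this

theorem realize_iff_of_qftp_eq {i : β → P} {j : β → Q} (h : qftp L i = qftp L j)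
    {φ : L.Formula β} (hφ : φ.IsQF) : φ.Realize i ↔ φ.Realize j := by
  have := Set.ext_iff.1 h φ
  simpa [qftp, tp, hφ] using this

/-- A tuple generating `P` with the same quantifier-free type as a tuple of `Q` induces an embedding
of `P` into `Q`. -/
theorem exists_embedding_of_qftp_eq {i : β → P} {j : β → Q} (h : qftp L i = qftp L j)
    (hi : Substructure.closure L (Set.range i) = ⊤) : ∃ f : P ↪[L] Q, f ∘ i = j := by
  have heq (s t : L.Term β) : s.realize i = t.realize i ↔ s.realize j = t.realize j := by
    have := realize_iff_of_qftp_eq h (φ := s.equal t) (BoundedFormula.IsAtomic.equal _ _).isQF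
    simpa using this
  have hrel {n : ℕ} (R : L.Relations n) (ts : Fin n → L.Term β) :
      Structure.RelMap R (fun k => (ts k).realize i) ↔
        Structure.RelMap R (fun k => (ts k).realize j) := by
    have := realize_iff_of_qftp_eq h (φ := R.formula ts) (BoundedFormula.IsAtomic.rel _ _).isQF
    simpa using this
  have hterm (p : P) : ∃ t : L.Term β, t.realize i = p := by
    have hp : p ∈ Substructure.closure L (Set.range i) := hi ▸ Substructure.mem_top p
    obtain ⟨t, rfl⟩ := Substructure.mem_closure_iff_exists_term.1 hp
    refine ⟨t.relabel fun q => q.2.choose, ?_⟩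
    rw [Term.realize_relabel]
    exact congrArg (fun v => t.realize v) (funext fun q => q.2.choose_spec)
  choose t ht using hterm
  have hvar (s : L.Term β) : (t (s.realize i)).realize j = s.realize j :=
    (heq _ _).1 (ht _)
  refine ⟨{ toFun := fun p => (t p).realize j, inj' := ?_, map_fun' := ?_, map_rel' := ?_ }, ?_⟩
  · intro p q hpq
    rw [← ht p, ← ht q]
    exact (heq _ _).2 hpq
  · intro n f xs
    have : Structure.funMap f xs = (Term.func f fun k => t (xs k)).realize i := by
      simp [ht]
    simp only [this, hvar]
    rfl
  · intro n R xs
    have := hrel R fun k => t (xs k)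
    simp only [ht] at this
    exact this.symm
  · ext b
    exact hvar (Term.var b)

end QuantifierFree

/-! ### Realising ultrafilter limits in saturated models -/

section Saturation

variable {L : FirstOrder.Language.{u, v}} {M : Type x} [L.Structure M]

/-- A formula in any set of variables is a relabelling of a formula in finitely many variables. -/
theorem exists_formula_fin {β : Type y} (φ : L.Formula β) :
    ∃ (n : ℕ) (i : Fin n → β) (ψ : L.Formula (Fin n)), ∀ v : β → M,
      φ.Realize v ↔ ψ.Realize (v ∘ i) := by
  classical
  let e := φ.freeVarFinset.equivFin
  refine ⟨_, fun k => (e.symm k : β), φ.restrictFreeVar e, fun v => ?_⟩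
  exact (BoundedFormula.realize_restrictFreeVar v fun a => by simp).symm

/-- Saturation for parameters given as a family, possibly with repetitions. -/
theorem IsSaturated.exists_realize {κ : Cardinal.{x}} (hM : IsSaturated L M κ) {ι : Type x}
    (hι : Cardinal.mk ι < κ) (f : ι → M) (p : Set (L.Formula (ι ⊕ Unit)))
    (hp : ∀ p₀ ⊆ p, p₀.Finite → ∃ b : M, ∀ φ ∈ p₀, φ.Realize (Sum.elim f fun _ => b)) :
    ∃ b : M, ∀ φ ∈ p, φ.Realize (Sum.elim f fun _ => b) := by
  let g : ι ⊕ Unit → Set.range f ⊕ Unit := Sum.map (Set.rangeFactorization f) id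
  have hg (φ : L.Formula (ι ⊕ Unit)) (b : M) :
      (φ.relabel g).Realize (Sum.elim (fun a : Set.range f => (a : M)) fun _ => b) ↔
        φ.Realize (Sum.elim f fun _ => b) := by
    rw [Formula.realize_relabel, Sum.elim_comp_map]
    rfl
  obtain ⟨b, hb⟩ := hM (Set.range f) (Cardinal.mk_range_le.trans_lt hι)
    ((fun φ : L.Formula (ι ⊕ Unit) => φ.relabel g) '' p) fun q hq hqf => by
      obtain ⟨p₀, hp₀, hf, rfl⟩ := Set.exists_subset_image_finite_and.1 ⟨q, hq, hqf, rfl⟩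
      obtain ⟨b, hb⟩ := hp p₀ hp₀ hf
      exact ⟨b, by rintro _ ⟨φ, hφ, rfl⟩; exact (hg φ b).2 (hb φ hφ)⟩
  exact ⟨b, fun φ hφ => (hg φ b).1 (hb _ ⟨φ, hφ, rfl⟩)⟩

/-- In a `κ`-saturated model, the limit type of any ultrafilter of tuples of length less than `κ` is
realised. The tuple is found, by Zorn's lemma, as a maximal partial map `I → M`
(represented by its graph) that satisfies the limit type. -/
theorem IsSaturated.exists_realize_ultrafilter {κ : Cardinal.{x}} (hM : IsSaturated L M κ)
    {I : Type x} (hI : Cardinal.mk I < κ) (U : Ultrafilter (I → M)) :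
    ∃ b : I → M, ∀ φ : L.Formula I, φ.Realize b ↔ ∀ᶠ v in (U : Filter (I → M)), φ.Realize v := by
  let S : Set (Set (I × M)) := {G |
    ∀ (n : ℕ) (φ : L.Formula (Fin n)) (i : Fin n → I) (w : Fin n → M),
    (∀ k, (i k, w k) ∈ G) → (∀ᶠ v in (U : Filter (I → M)), φ.Realize (v ∘ i)) → φ.Realize w}
  obtain ⟨G, -, hG⟩ := zorn_subset_nonempty S (fun c hc hch hne => by
    refine ⟨⋃₀ c, fun n φ i w hw => ?_, fun s hs => Set.subset_sUnion_of_mem hs⟩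
    obtain ⟨s, hs, hsub⟩ := hch.directedOn.exists_mem_subset_of_finite_of_subset_sUnion hne
      (Set.finite_range fun k => (i k, w k)) (by rintro _ ⟨k, rfl⟩; exact hw k)
    exact hc hs n φ i w fun k => hsub ⟨k, rfl⟩) ∅ (fun n φ i w hw h => by
      cases n with
      | zero =>
        obtain ⟨v, hv⟩ := h.exists
        rwa [Subsingleton.elim (v ∘ i) w] at hv
      | succ n => exact (hw 0).elim)
  have hfun {i : I} {b c : M} (hb : (i, b) ∈ G) (hc : (i, c) ∈ G) : b = c := by
    have := hG.prop 2 ((Term.var 0).equal (Term.var 1)) ![i, i] ![b, c]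
      (by intro k; fin_cases k <;> assumption) (by simp)
    simpa using this
  have hdom (i₀ : I) : ∃ b, (i₀, b) ∈ G := by
    by_contra hi₀
    -- Realise the limit type of the coordinate `i₀` over the values chosen so far.
    let D : Type x := {i : I // ∃ b, (i, b) ∈ G}
    choose f hf using fun i : D => i.2
    let p : Set (L.Formula (D ⊕ Unit)) :=
      {ψ | ∀ᶠ v in (U : Filter (I → M)), ψ.Realize (Sum.elim (fun i : D => v i) fun _ => v i₀)}
    obtain ⟨b, hb⟩ := hM.exists_realize ((Cardinal.mk_subtype_le _).trans_lt hI) f p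
      fun p₀ hp₀ hfin => by
        have := hfin.to_subtype
        let θ : L.Formula D :=
          Formula.iExs Unit (Formula.iInf fun φ : p₀ => (φ : L.Formula (D ⊕ Unit)))
        have hθ (w : D → M) : θ.Realize w ↔ ∃ b, ∀ φ ∈ p₀, φ.Realize (Sum.elim w fun _ => b) := by
          simp only [θ, Formula.realize_iExs, Formula.realize_iInf, Subtype.forall]
          exact ⟨fun ⟨b, hb⟩ => ⟨b (), hb⟩, fun ⟨b, hb⟩ => ⟨fun _ => b, hb⟩⟩
        rw [← hθ]
        obtain ⟨n, i, ψ, hψ⟩ := exists_formula_fin (M := M) θ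
        rw [hψ]
        refine hG.prop n ψ (fun k => i k) (f ∘ i) (fun k => hf (i k)) ?_
        filter_upwards [(eventually_all_finite hfin).2 hp₀] with v hv
        exact (hψ fun i => v i).1 ((hθ _).2 ⟨_, hv⟩)
    refine hi₀ ⟨b, ?_⟩
    refine hG.le_of_ge (y := insert (i₀, b) G) (fun n φ i w hw h => ?_) (Set.subset_insert _ _)
      (Set.mem_insert _ _)
    classical
    let g : I → D ⊕ Unit := fun i => if h : ∃ b, (i, b) ∈ G then Sum.inl ⟨i, h⟩ else Sum.inr ()
    have hwg : w = (Sum.elim f fun _ => b) ∘ g ∘ i := by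
      ext k
      rcases hw k with hk | hk
      · obtain ⟨h₁, h₂⟩ := Prod.mk.inj hk
        simp [g, h₁, h₂, dif_neg hi₀]
      · have hk' : ∃ b, (i k, b) ∈ G := ⟨_, hk⟩
        simp only [g, Function.comp, dif_pos hk', Sum.elim_inl]
        exact hfun hk (hf ⟨i k, hk'⟩)
    have hvg (v : I → M) : v ∘ i = (Sum.elim (fun i : D => v i) fun _ => v i₀) ∘ g ∘ i := by
      ext k
      rcases hw k with hk | hk
      · simp [g, (Prod.mk.inj hk).1, dif_neg hi₀]
      · have hk' : ∃ b, (i k, b) ∈ G := ⟨_, hk⟩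
        simp only [g, Function.comp, dif_pos hk', Sum.elim_inl]
    rw [hwg, ← Formula.realize_relabel]
    refine hb _ ?_
    filter_upwards [h] with v hv
    rwa [Formula.realize_relabel, ← hvg]
  choose b hb using hdom
  have key (φ : L.Formula I) (h : ∀ᶠ v in (U : Filter (I → M)), φ.Realize v) : φ.Realize b := by
    obtain ⟨n, i, ψ, hψ⟩ := exists_formula_fin (M := M) φ
    rw [hψ]
    exact hG.prop n ψ i (b ∘ i) (fun k => hb (i k)) (h.mono fun v hv => (hψ v).1 hv)
  refine ⟨b, fun φ => ⟨fun h => ?_, key φ⟩⟩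
  by_contra hcon
  exact key φ.not (Ultrafilter.eventually_not.2 hcon) h

end Saturation

/-! ### Types of tuples -/

section Types

variable {L : FirstOrder.Language.{u, v}} {M : Type x} [L.Structure M] {α : Type y} {β : Type z}

theorem tp_comp {a b : α → M} (h : tp L a = tp L b) (g : β → α) : tp L (a ∘ g) = tp L (b ∘ g) := by
  ext φ
  have := Set.ext_iff.1 h (φ.relabel g)
  simpa [tp, Formula.realize_relabel] using this

theorem deltaTp_eq_iff {Δ : Set (L.Formula α)} {a b : α → M} :
    deltaTp L Δ a = deltaTp L Δ b ↔ ∀ φ ∈ Δ, φ.Realize a ↔ φ.Realize b := by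
  constructor
  · intro h φ hφ
    have := Set.ext_iff.1 h φ
    simpa [deltaTp, tp, hφ] using this
  · intro h
    ext φ
    refine and_congr_left fun hφ => ?_
    rcases hφ with hφ | hφ
    · exact h φ hφ
    · exact not_iff_not.1 (h _ hφ)

theorem ModelsSequences.congr {L' : FirstOrder.Language.{u', v'}} {N : Type w} [L'.Structure N]
    (e : α ≃ β) (h : ModelsSequences L' N L M α) : ModelsSequences L' N L M β := by
  intro a
  obtain ⟨b, hb, hba⟩ := h fun i => a i ∘ e
  refine ⟨fun i => b i ∘ e.symm, fun n i j hij => ?_, fun n Δ hΔ i => ?_⟩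
  · exact tp_comp (hb n i j hij) (Prod.map id e.symm)
  · obtain ⟨j, hij, hj⟩ := hba n ((fun φ : L.Formula (Fin n × β) =>
      φ.relabel (Prod.map id e.symm)) '' Δ) (hΔ.image _) i
    refine ⟨j, hij, deltaTp_eq_iff.2 fun φ hφ => ?_⟩
    have := deltaTp_eq_iff.1 hj _ ⟨φ, hφ, rfl⟩
    simpa [Formula.realize_relabel, Function.comp_def] using this

theorem HasMP.hasFiniteMP {L' : FirstOrder.Language.{u', v'}} {N : Type w} [L'.Structure N]
    [Infinite N] (h : HasMP.{u, v} L' N) : HasFiniteMP.{u, v} L' N := by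
  intro L T hT hinf κ M _ hM m
  refine ModelsSequences.congr Equiv.ulift (h L T hT hinf κ M hM (ULift (Fin m)) ?_)
  refine lt_of_lt_of_le ?_ ((Cardinal.aleph0_le_lift.2 (Cardinal.aleph0_le_mk N)).trans
    hM.card_index_lt.le)
  simp

end Types

/-! ### The age of a locally finite structure -/

section Age

variable {L' : FirstOrder.Language.{u', v'}} {N : Type w} [L'.Structure N]

theorem IsLocallyFinite.finite_of_mem_age (hN : IsLocallyFinite L' N)
    {A : CategoryTheory.Bundled.{w} L'.Structure} (hA : A ∈ L'.age N) : Finite A := by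
  obtain ⟨⟨S, hS⟩, ⟨f⟩⟩ := hA
  have h := hN (f '' S) (S.finite_toSet.image f)
  have hmap : Substructure.closure L' (f '' S) = (⊤ : L'.Substructure A).map f.toHom := by
    rw [← hS]
    exact Substructure.closure_image f.toHom
  rw [hmap] at h
  have := h.to_subtype
  refine Finite.of_injective (β := ((⊤ : L'.Substructure A).map f.toHom : Set N))
    (fun p => ⟨f p, p, trivial, rfl⟩) fun p q hpq => ?_
  exact f.injective (congrArg Subtype.val hpq)

theorem isRamseyClass_age_iff (hN : IsLocallyFinite L' N) :
    IsRamseyClass (L'.age N) ↔ HasERP (L'.age N) :=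
  ⟨fun h => h.erp, fun h =>
    { finite := fun _ hA => hN.finite_of_mem_age hA
      iso_closed := fun A B hAB hA => (age.is_equiv_invariant L' N A B hAB).1 hA
      hereditary := age.hereditary N
      jointEmbedding := age.jointEmbedding N
      erp := h }⟩

end Age

/-! ### The modelling property from the Ramsey property -/

section Modelling

variable {L' : FirstOrder.Language.{u', v'}} {N : Type w} [L'.Structure N]

/-- Finitely many colourings, one for each `A i`, can be made homogeneous on a single copy of `C`:
the Ramsey property is applied once for each of them. -/
theorem HasERP.exists_homogeneous (hE : HasERP (L'.age N)) {ι : Type*}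
    {A : ι → CategoryTheory.Bundled.{w} L'.Structure} (hA : ∀ i, A i ∈ L'.age N)
    (χ : ∀ i, (A i ↪[L'] N) → Prop) (s : Finset ι) :
    ∀ C ∈ L'.age N, ∃ f : C ↪[L'] N, ∀ i ∈ s, ∀ g h : A i ↪[L'] C,
      χ i (f.comp g) ↔ χ i (f.comp h) := by
  classical
  induction s using Finset.induction_on with
  | empty => exact fun C hC => ⟨hC.2.some, by simp⟩
  | insert i s _ ih =>
    intro C hC
    by_cases hAC : Nonempty (A i ↪[L'] C)
    · obtain ⟨D, hD, hArr⟩ := hE (A i) (hA i) C hC hAC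
      obtain ⟨f, hf⟩ := ih D hD
      obtain ⟨f', hf'⟩ := hArr fun e => if χ i (f.comp e) then 0 else 1
      refine ⟨f.comp f', fun k hk g h => ?_⟩
      rcases Finset.mem_insert.1 hk with rfl | hk
      · have := hf' g h
        simp only [Embedding.comp_assoc]
        split_ifs at this <;> simp_all
      · exact hf k hk (f'.comp g) (f'.comp h)
    · obtain ⟨f, hf⟩ := ih C hC
      refine ⟨f, fun k hk g h => ?_⟩
      rcases Finset.mem_insert.1 hk with rfl | hk
      · exact (hAC ⟨g⟩).elim
      · exact hf k hk g h

/-- A finite approximation of an indiscernible sequence based on `a`: move `a` along an embedding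
of the substructure generated by `S` that is homogeneous for the types of tuples of `a` in the
finitely many formulas of `Φ`. -/
theorem HasERP.exists_approximation (hE : HasERP (L'.age N))
    {L : FirstOrder.Language.{u, v}} {M : Type x} [L.Structure M] {α : Type y} (a : N → α → M)
    (S : Finset N) (Φ : Finset (Σ n, L.Formula (Fin n × α))) :
    ∃ b : N → α → M,
      (∀ (n : ℕ) (i : Fin n → N), (∀ k, i k ∈ S) →
        ∃ j : Fin n → N, qftp L' i = qftp L' j ∧ ∀ k, b (i k) = a (j k)) ∧
      ∀ φ ∈ Φ, ∀ i j : Fin φ.1 → N, (∀ k, i k ∈ S) → (∀ k, j k ∈ S) → qftp L' i = qftp L' j →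
        (φ.2.Realize (fun k => b (i k.1) k.2) ↔ φ.2.Realize (fun k => b (j k.1) k.2)) := by
  classical
  let B : L'.Substructure N := Substructure.closure L' S
  have hB : CategoryTheory.Bundled.mk B ∈ L'.age N :=
    age.fg_substructure (Substructure.fg_closure S.finite_toSet)
  have hSB (s : N) (hs : s ∈ S) : s ∈ B := Substructure.subset_closure hs
  let ι := Σ φ : Φ, Fin φ.1.1 → S
  let A : ι → L'.Substructure N := fun t => Substructure.closure L' (Set.range fun k => (t.2 k : N))
  let e (t : ι) (k : Fin t.1.1.1) : A t := ⟨t.2 k, Substructure.subset_closure ⟨k, rfl⟩⟩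
  have hgen (t : ι) : Substructure.closure L' (Set.range (e t)) = ⊤ := by
    refine Substructure.map_injective_of_injective (f := (A t).subtype.toHom)
      (A t).subtype.injective ?_
    rw [← Substructure.closure_image, ← Set.range_comp]
    simp only [← Hom.range_eq_map]
    exact (Substructure.range_subtype (A t)).symm
  obtain ⟨f, hf⟩ := hE.exists_homogeneous (A := fun t => CategoryTheory.Bundled.mk (A t))
    (fun t => age.fg_substructure (Substructure.fg_closure (Set.finite_range _)))
    (fun t g => t.1.1.2.Realize fun k => a (g (e t k.1)) k.2) Finset.univ _ hB
  let b : N → α → M := fun s => if h : s ∈ B then a (f ⟨s, h⟩) else a s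
  have hb (s : N) (hs : s ∈ S) : b s = a (f ⟨s, hSB s hs⟩) := dif_pos (hSB s hs)
  refine ⟨b, fun n i hi => ⟨fun k => f ⟨i k, hSB _ (hi k)⟩, ?_, fun k => hb _ (hi k)⟩, ?_⟩
  · exact (qftp_comp_embedding B.subtype fun k => ⟨i k, hSB _ (hi k)⟩).trans
      (qftp_comp_embedding f _).symm
  · rintro φ hφ i j hi hj hij
    let t : ι := ⟨⟨φ, hφ⟩, fun k => ⟨i k, hi k⟩⟩
    have hext (j : Fin φ.1 → N) (hj : ∀ k, j k ∈ S) (hij : qftp L' i = qftp L' j) :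
        ∃ g : A t ↪[L'] B, ∀ k, g (e t k) = ⟨j k, hSB _ (hj k)⟩ := by
      obtain ⟨g, hg⟩ := exists_embedding_of_qftp_eq (i := e t)
        (j := fun k => (⟨j k, hSB _ (hj k)⟩ : B))
        ((qftp_comp_embedding (A t).subtype _).symm.trans
          (hij.trans (qftp_comp_embedding B.subtype fun k => ⟨j k, hSB _ (hj k)⟩))) (hgen t)
      exact ⟨g, congrFun hg⟩
    obtain ⟨g, hg⟩ := hext i hi rfl
    obtain ⟨h, hh⟩ := hext j hj hij
    have := hf t (Finset.mem_univ _) g h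
    simp only [Embedding.comp_apply, hg, hh] at this
    simpa only [hb _ (hi _), hb _ (hj _)] using this

/-- Compactness: an ultrafilter limit of the finite approximations is realised in a saturated
model. -/
theorem HasERP.modelsSequences [Infinite N] (hE : HasERP (L'.age N))
    {L : FirstOrder.Language.{u, v}} {M : Type (max u v w)} [L.Structure M]
    {κ : Cardinal.{max u v w}} (hM : IsSaturated L M κ)
    (hκ : Cardinal.lift.{max u v} (Cardinal.mk N) < κ)
    {α : Type (max u v w)} (hα : Cardinal.mk α < κ) : ModelsSequences L' N L M α := by
  classical
  intro a
  have hI : Cardinal.mk (N × α) < κ := by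
    rw [Cardinal.mk_prod]
    refine Cardinal.mul_lt_of_lt
      ((Cardinal.aleph0_le_lift.2 (Cardinal.aleph0_le_mk N)).trans hκ.le) ?_ ?_
    · rwa [Cardinal.lift_umax.{w, max u v}]
    · rwa [Cardinal.lift_id'.{w, max u v w}]
  choose c hc hc' using fun d : Finset N × Finset (Σ n, L.Formula (Fin n × α)) =>
    hE.exists_approximation a d.1 d.2
  let F : Filter (N × α → M) := map (fun d p => c d p.1 p.2) atTop
  let U : Ultrafilter (N × α → M) := Ultrafilter.of F
  have hU {p : (N × α → M) → Prop} (S : Finset N) (Φ : Finset (Σ n, L.Formula (Fin n × α)))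
      (h : ∀ d, S ⊆ d.1 → Φ ⊆ d.2 → p fun q => c d q.1 q.2) :
      ∀ᶠ v in (U : Filter (N × α → M)), p v := by
    refine Ultrafilter.of_le F ?_
    exact eventually_map.2 ((eventually_ge_atTop (S, Φ)).mono fun d hd => h d hd.1 hd.2)
  obtain ⟨b, hb⟩ := hM.exists_realize_ultrafilter hI U
  have hb' {n : ℕ} (i : Fin n → N) (φ : L.Formula (Fin n × α)) :
      φ.Realize (fun k => b (i k.1, k.2)) ↔
        ∀ᶠ v in (U : Filter (N × α → M)), φ.Realize fun k => v (i k.1, k.2) := by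
    simpa only [Formula.realize_relabel, Function.comp_def] using
      hb (φ.relabel fun k => (i k.1, k.2))
  refine ⟨fun s t => b (s, t), fun n i j hij => ?_, fun n Δ hΔ i => ?_⟩
  · ext φ
    refine (hb' i φ).trans (Iff.trans ?_ (hb' j φ).symm)
    refine eventually_congr (hU (Finset.univ.image i ∪ Finset.univ.image j) {⟨n, φ⟩} ?_)
    intro d hS hΦ
    exact hc' d ⟨n, φ⟩ (hΦ (by simp)) i j (fun k => hS (by simp)) (fun k => hS (by simp)) hij
  · have h₁ : ∀ᶠ v in (U : Filter (N × α → M)), ∃ j : Fin n → N, qftp L' i = qftp L' j ∧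
        ∀ k s, v (i k, s) = a (j k) s := by
      refine hU (Finset.univ.image i) ∅ fun d hS _ => ?_
      obtain ⟨j, hij, hj⟩ := hc d n i fun k => hS (by simp)
      exact ⟨j, hij, fun k s => congrFun (hj k) s⟩
    have h₂ : ∀ᶠ v in (U : Filter (N × α → M)), ∀ φ ∈ Δ,
        (φ.Realize (fun k => b (i k.1, k.2)) ↔ φ.Realize fun k => v (i k.1, k.2)) := by
      refine (eventually_all_finite hΔ).2 fun φ _ => ?_
      by_cases h : φ.Realize fun k => b (i k.1, k.2)
      · exact ((hb' i φ).1 h).mono fun v hv => iff_of_true h hv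
      · exact (Ultrafilter.eventually_not.2 (mt (hb' i φ).2 h)).mono fun v hv => iff_of_false h hv
    obtain ⟨v, ⟨j, hij, hj⟩, hv⟩ := (h₁.and h₂).exists
    refine ⟨j, hij, deltaTp_eq_iff.2 fun φ hφ => ?_⟩
    simpa only [hj] using hv φ hφ

end Modelling

/-! ### A saturated hypergraph extending a given one -/

section Hypergraph

/-- The language with a single relation symbol, of arity `n`. -/
def hypergraphLanguage (n : ℕ) : FirstOrder.Language.{u, v} where
  Functions _ := PEmpty
  Relations k := ULift (PLift (k = n))

instance (n k : ℕ) : IsEmpty ((hypergraphLanguage.{u, v} n).Functions k) :=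
  inferInstanceAs (IsEmpty PEmpty)

instance (n k : ℕ) : Subsingleton ((hypergraphLanguage.{u, v} n).Relations k) :=
  inferInstanceAs (Subsingleton (ULift (PLift (k = n))))

/-- The relation symbol of the language of `n`-hypergraphs. -/
def edgeSymbol (n : ℕ) : (hypergraphLanguage.{u, v} n).Relations n :=
  ULift.up (PLift.up rfl)

theorem card_hypergraphLanguage_le (n : ℕ) :
    (hypergraphLanguage.{u, v} n).card ≤ Cardinal.aleph0 := by
  have : Countable (hypergraphLanguage.{u, v} n).Symbols := by
    unfold Language.Symbols
    infer_instance
  exact Cardinal.mk_le_aleph0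

variable {W : Type x} {n : ℕ}

/-- The vertices of a saturated `n`-hypergraph that extends the hypergraph `R` on `W`. A new vertex
`node f c` lies over a family `f` of earlier vertices, and `c` prescribes its edges to them; the
value `none` marks the places of the new vertex itself in an `n`-tuple. -/
inductive GenericHypergraph (R : Set (Fin n → W)) : Type x
  | base : W → GenericHypergraph R
  | node : (W → GenericHypergraph R) → Set (Fin n → Option W) → GenericHypergraph R

namespace GenericHypergraph

variable {R : Set (Fin n → W)}

/-- The edges are those of `R`, and those prescribed by a vertex `node f c` between itself and the
vertices `f w`. -/
def Edge (t : Fin n → GenericHypergraph R) : Prop :=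
  (∃ s ∈ R, t = base ∘ s) ∨
    ∃ (f : W → GenericHypergraph R) (c : Set (Fin n → Option W)), ∃ k ∈ c,
      (∃ j, k j = none) ∧ t = fun j => (k j).elim (node f c) f

instance : (hypergraphLanguage.{u, v} n).Structure (GenericHypergraph R) where
  funMap f := isEmptyElim f
  RelMap r t := Edge (t ∘ Fin.cast r.down.down.symm)

theorem relMap_edgeSymbol (t : Fin n → GenericHypergraph R) :
    Structure.RelMap (edgeSymbol.{u, v} n) t ↔ Edge t :=
  Iff.rfl

theorem edge_base (s : Fin n → W) : Edge (base ∘ s : Fin n → GenericHypergraph R) ↔ s ∈ R := by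
  constructor
  · rintro (⟨s', hs', h⟩ | ⟨f, c, k, -, ⟨j, hj⟩, h⟩)
    · have : s = s' := funext fun j => base.inj (congrFun h j)
      rwa [this]
    · have := congrFun h j
      simp [hj] at this
  · exact fun h => Or.inl ⟨s, h, rfl⟩

/-- `Below a b` holds if `b` was introduced over a family containing `a`. -/
def Below (a b : GenericHypergraph R) : Prop :=
  ∃ f c w, b = node f c ∧ a = f w

theorem wellFounded_below : WellFounded (Below (R := R)) := by
  refine ⟨fun b => ?_⟩
  induction b with
  | base w => exact Acc.intro _ (by rintro a ⟨f, c, w, h, -⟩; cases h)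
  | node f c ih =>
    refine Acc.intro _ ?_
    rintro _ ⟨f', c', w, h, rfl⟩
    cases h
    exact ih w

theorem node_ne (f : W → GenericHypergraph R) (c w) : f w ≠ node f c := fun h =>
  have hb : Below (node f c) (node f c) := ⟨f, c, w, rfl, h.symm⟩
  wellFounded_below.asymmetric _ _ hb hb

/-- The extension property: the edges between a new vertex and a small set can be prescribed. -/
theorem exists_prescribed (A : Set (GenericHypergraph R)) (hA : Cardinal.mk A ≤ Cardinal.mk W)
    (E : Set (Fin n → Option (GenericHypergraph R))) :
    ∃ y ∉ A, ∀ k : Fin n → Option (GenericHypergraph R), (∃ j, k j = none) →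
      (∀ j, ∀ g ∈ k j, g ∈ A) → (Edge (fun j => (k j).elim y id) ↔ k ∈ E) := by
  obtain ⟨e⟩ := hA
  let f : W → GenericHypergraph R := Function.extend e Subtype.val base
  have hf (g) (hg : g ∈ A) : f (e ⟨g, hg⟩) = g := e.injective.extend_apply _ _ _
  let c : Set (Fin n → Option W) := {k | (fun j => (k j).map f) ∈ E}
  have hy : node f c ∉ A := fun h => node_ne f c _ (hf _ h)
  refine ⟨node f c, hy, fun k ⟨j₀, hj₀⟩ hk => ⟨?_, fun h => ?_⟩⟩
  · rintro (⟨s, -, h⟩ | ⟨f', c', k', hk', ⟨j₁, hj₁⟩, h⟩)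
    · have := congrFun h j₀
      simp [hj₀] at this
    · have hfc : node f c = node f' c' := by
        have h₀ := congrFun h j₀
        have h₁ := congrFun h j₁
        simp only [hj₀, hj₁, Option.elim_none] at h₀ h₁
        -- Otherwise each of the two vertices was introduced over the other one.
        by_contra hne
        cases hk₁ : k j₁ with
        | none => simp [hk₁, hne] at h₁
        | some g =>
          cases hk₀ : k' j₀ with
          | none => simp [hk₀, hne] at h₀
          | some w =>
            simp only [hk₁, hk₀, Option.elim_some, id] at h₀ h₁
            refine wellFounded_below.asymmetric (a := node f c) (b := node f' c')
              ⟨f', c', w, rfl, h₀⟩ ⟨f, c, e ⟨g, hk j₁ g hk₁⟩, rfl, ?_⟩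
            rw [hf, h₁]
      cases hfc
      have : k = fun j => (k' j).map f := by
        ext1 j
        have hj := congrFun h j
        cases hk₁ : k j with
        | none =>
          cases hk₀ : k' j with
          | none => rfl
          | some w =>
            simp only [hk₁, hk₀, Option.elim_none, Option.elim_some] at hj
            exact (node_ne f c w hj.symm).elim
        | some g =>
          cases hk₀ : k' j with
          | none =>
            simp only [hk₁, hk₀, Option.elim_none, Option.elim_some, id] at hj
            exact (hy (hj ▸ hk j g hk₁)).elim
          | some w => simpa [hk₁, hk₀] using hj
      rw [this]
      exact hk'
  · have hk' (j) : ∃ o : Option W, o.map f = k j := by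
      cases hkj : k j with
      | none => exact ⟨none, rfl⟩
      | some g => exact ⟨some (e ⟨g, hk j g hkj⟩), congrArg some (hf _ _)⟩
    choose k' hk' using hk'
    refine Or.inr ⟨f, c, k', ?_, ⟨j₀, by simpa [hj₀] using hk' j₀⟩, ?_⟩
    · simpa only [c, Set.mem_ofPred_eq, hk'] using h
    · ext1 j
      rw [← hk' j]
      cases k' j <;> rfl

/-- Two tuples have the same atomic type. -/
def SameAtomicType {β : Type y} (a b : β → GenericHypergraph R) : Prop :=
  (∀ i j, a i = a j ↔ b i = b j) ∧ ∀ k : Fin n → β, Edge (a ∘ k) ↔ Edge (b ∘ k)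

namespace SameAtomicType

variable {β : Type y} {γ : Type z} {a b : β → GenericHypergraph R}

theorem symm (h : SameAtomicType a b) : SameAtomicType b a :=
  ⟨fun i j => (h.1 i j).symm, fun k => (h.2 k).symm⟩

theorem comp (h : SameAtomicType a b) (g : γ → β) : SameAtomicType (a ∘ g) (b ∘ g) :=
  ⟨fun i j => h.1 (g i) (g j), fun k => h.2 (g ∘ k)⟩

theorem extend (h : SameAtomicType a b) (hb : Cardinal.mk (Set.range b) ≤ Cardinal.mk W)
    (c : GenericHypergraph R) :
    ∃ d, SameAtomicType (fun o : Option β => o.elim c a) (fun o => o.elim d b) := by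
  by_cases hc : ∃ i, a i = c
  · obtain ⟨i, rfl⟩ := hc
    refine ⟨b i, ?_⟩
    convert h.comp (fun o : Option β => o.getD i) using 1 <;>
    · ext1 o
      cases o <;> rfl
  obtain ⟨d, hd, hdE⟩ := exists_prescribed (Set.range b) hb
    {k | ∃ k' : Fin n → Option β, (∀ j, (k' j).map b = k j) ∧ Edge fun j => (k' j).elim c a}
  refine ⟨d, ?_, fun k => ?_⟩
  · rintro (_ | i) (_ | j)
    · simp
    · exact iff_of_false (fun h => hc ⟨j, h.symm⟩) fun h => hd ⟨j, h.symm⟩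
    · exact iff_of_false (fun h => hc ⟨i, h⟩) fun h => hd ⟨i, h⟩
    · exact h.1 i j
  · by_cases hk : ∃ j, k j = none
    · have := hdE (fun j => (k j).map b) (hk.imp fun j hj => by simp [hj]) (by
        intro j g hg
        obtain ⟨i, -, rfl⟩ := Option.mem_map.1 hg
        exact ⟨i, rfl⟩)
      have hel : (fun j => ((k j).map b).elim d id) = (fun o : Option β => o.elim d b) ∘ k := by
        ext1 j
        simp only [Function.comp]
        cases k j <;> rfl
      rw [hel] at this
      rw [this]
      refine ⟨fun hE => ⟨k, fun _ => rfl, hE⟩, fun ⟨k', hk', hE⟩ => ?_⟩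
      convert hE using 1
      ext1 j
      have hj := hk' j
      simp only [Function.comp]
      cases h₁ : k j with
      | none =>
        cases h₂ : k' j with
        | none => rfl
        | some i => simp [h₁, h₂] at hj
      | some i =>
        cases h₂ : k' j with
        | none => simp [h₁, h₂] at hj
        | some i' =>
          simp only [h₁, h₂, Option.map_some, Option.some.injEq] at hj
          exact (h.1 i i').2 hj.symm
    · have hk' (j) : ∃ i, k j = some i := Option.ne_none_iff_exists'.1 fun hj => hk ⟨j, hj⟩
      choose k' hk' using hk'
      obtain rfl : k = some ∘ k' := funext hk'
      exact h.2 k'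

/-- Back and forth: in finitely many variables, formulas are determined by the atomic type. -/
theorem realize_iff [Infinite W] [Finite β] {m : ℕ}
    (φ : (hypergraphLanguage.{u, v} n).BoundedFormula β m) {xs ys : Fin m → GenericHypergraph R}
    (h : SameAtomicType (Sum.elim a xs) (Sum.elim b ys)) : φ.Realize a xs ↔ φ.Realize b ys := by
  induction φ with
  | falsum => rfl
  | equal s t =>
    cases s with
    | func f => exact isEmptyElim f
    | var i =>
      cases t with
      | func f => exact isEmptyElim f
      | var j => exact h.1 i j
  | @rel m l r ts =>
    obtain ⟨⟨rfl⟩⟩ := r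
    have (k : Fin l) : ∃ i, ts k = Term.var i := by
      cases ts k with
      | func f => exact isEmptyElim f
      | var i => exact ⟨i, rfl⟩
    choose k hk using this
    obtain rfl : ts = fun j => Term.var (k j) := funext hk
    exact h.2 k
  | imp _ _ h₁ h₂ => exact imp_congr (h₁ h) (h₂ h)
  | @all m φ ih =>
    have key {a b : β → GenericHypergraph R} {xs ys : Fin m → GenericHypergraph R}
        (h : SameAtomicType (Sum.elim a xs) (Sum.elim b ys)) (c) :
        ∃ d, SameAtomicType (Sum.elim a (Fin.snoc xs c : Fin (m + 1) → _))
          (Sum.elim b (Fin.snoc ys d : Fin (m + 1) → _)) := by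
      obtain ⟨d, hd⟩ := h.extend
        ((Cardinal.lt_aleph0_of_finite _).le.trans (Cardinal.aleph0_le_mk W)) c
      refine ⟨d, ?_⟩
      have := hd.comp (Sum.elim (some ∘ Sum.inl)
        (Fin.snoc (some ∘ Sum.inr) none : Fin (m + 1) → Option (β ⊕ Fin m)))
      convert this using 1 <;>
      · ext1 i
        rcases i with i | i
        · rfl
        · refine Fin.lastCases ?_ (fun i => ?_) i <;> simp
    simp only [BoundedFormula.realize_all]
    constructor
    · intro H d
      obtain ⟨c, hc⟩ := key h.symm d
      exact (ih hc.symm).1 (H c)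
    · intro H c
      obtain ⟨d, hd⟩ := key h c
      exact (ih hd).2 (H d)

theorem formula_realize_iff [Infinite W] (h : SameAtomicType a b)
    (φ : (hypergraphLanguage.{u, v} n).Formula β) : φ.Realize a ↔ φ.Realize b := by
  obtain ⟨m, i, ψ, hψ⟩ := exists_formula_fin (M := GenericHypergraph R) φ
  rw [hψ, hψ]
  refine realize_iff ψ ?_
  convert (h.comp i).comp (Sum.elim id (default : Fin 0 → Fin m)) using 1 <;>
  · ext1 j
    rcases j with j | j
    · rfl
    · exact j.elim0

theorem of_tp_eq (h : tp (hypergraphLanguage.{u, v} n) a = tp (hypergraphLanguage.{u, v} n) b) :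
    SameAtomicType a b := by
  constructor
  · intro i j
    have := Set.ext_iff.1 h ((Term.var i).equal (Term.var j))
    simpa [tp] using this
  · intro k
    have := Set.ext_iff.1 h ((edgeSymbol n).formula fun j => Term.var (k j))
    simpa [tp, relMap_edgeSymbol, Function.comp_def] using this

end SameAtomicType

theorem isHomogeneous [Infinite W] :
    IsHomogeneous (hypergraphLanguage.{u, v} n) (GenericHypergraph R)
      (Order.succ (Cardinal.mk W)) := by
  intro A hA f hf c
  obtain ⟨d, hd⟩ := (SameAtomicType.of_tp_eq hf).extend
    (Cardinal.mk_range_le.trans (Order.lt_succ_iff.1 hA)) c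
  refine ⟨d, ?_⟩
  ext φ
  refine SameAtomicType.formula_realize_iff ?_ φ
  convert hd.comp (Sum.elim some fun _ => none) using 1 <;>
  · ext1 i
    rcases i with i | i <;> rfl

theorem isSaturated [Infinite W] :
    IsSaturated (hypergraphLanguage.{u, v} n) (GenericHypergraph R)
      (Order.succ (Cardinal.mk W)) := by
  classical
  intro A hA p hp
  let ev (x : GenericHypergraph R) : A ⊕ Unit → GenericHypergraph R :=
    Sum.elim (fun a : A => (a : GenericHypergraph R)) fun _ => x
  obtain ⟨U, hU⟩ := Ultrafilter.exists_ultrafilter_of_finite_inter_nonempty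
    ((fun φ : (hypergraphLanguage n).Formula (A ⊕ Unit) => {x | φ.Realize (ev x)}) '' p) (by
      intro T hT
      obtain ⟨p₀, hp₀, hf, h⟩ := Set.exists_subset_image_finite_and.1
        ⟨(T : Set (Set (GenericHypergraph R))), hT, T.finite_toSet, rfl⟩
      obtain ⟨b, hb⟩ := hp p₀ hp₀ hf
      refine ⟨b, ?_⟩
      rw [h]
      rintro _ ⟨φ, hφ, rfl⟩
      exact hb φ hφ)
  have hU' (φ) (hφ : φ ∈ p) : ∀ᶠ x in (U : Filter (GenericHypergraph R)), φ.Realize (ev x) :=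
    hU ⟨φ, hφ, rfl⟩
  by_cases hpr : ∃ a ∈ A, ∀ᶠ x in (U : Filter (GenericHypergraph R)), x = a
  · obtain ⟨a, -, ha⟩ := hpr
    refine ⟨a, fun φ hφ => ?_⟩
    obtain ⟨x, hx, rfl⟩ := ((hU' φ hφ).and ha).exists
    exact hx
  -- Otherwise the limit type is that of a vertex outside `A`, with the limit edges.
  obtain ⟨y, hy, hyE⟩ := exists_prescribed A (Order.lt_succ_iff.1 hA)
    {k | ∀ᶠ x in (U : Filter (GenericHypergraph R)), Edge fun j => (k j).elim x id}
  have hne (a) (ha : a ∈ A) : ∀ᶠ x in (U : Filter (GenericHypergraph R)), x ≠ a :=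
    Ultrafilter.eventually_not.2 fun h => hpr ⟨a, ha, h⟩
  have heq (s t : A ⊕ Unit) : ∀ᶠ x in (U : Filter (GenericHypergraph R)),
      (ev x s = ev x t ↔ ev y s = ev y t) := by
    rcases s with s | s <;> rcases t with t | t
    · exact Eventually.of_forall fun _ => Iff.rfl
    · exact (hne s s.2).mono fun x hx =>
        iff_of_false (fun h => hx h.symm) fun h =>
          hy ((show (s : GenericHypergraph R) = y from h) ▸ s.2)
    · exact (hne t t.2).mono fun x hx => iff_of_false hx fun h =>
        hy ((show y = (t : GenericHypergraph R) from h) ▸ t.2)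
    · exact Eventually.of_forall fun _ => iff_of_true rfl rfl
  have hedge (k : Fin n → A ⊕ Unit) : ∀ᶠ x in (U : Filter (GenericHypergraph R)),
      (Edge (ev x ∘ k) ↔ Edge (ev y ∘ k)) := by
    by_cases hk : ∃ j, k j = Sum.inr ()
    · let o : A ⊕ Unit → Option (GenericHypergraph R) :=
        Sum.elim (fun a => some (a : GenericHypergraph R)) fun _ => none
      have ho (x) : (fun j => (o (k j)).elim x id) = ev x ∘ k := by
        ext1 j
        simp only [Function.comp]
        cases k j <;> rfl
      have := hyE (fun j => o (k j)) (hk.imp fun j hj => by simp [hj, o]) (by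
        intro j g hg
        cases hkj : k j with
        | inl a =>
          simp only [hkj, o, Sum.elim_inl, Option.mem_some_iff] at hg
          exact hg ▸ a.2
        | inr => simp [hkj, o] at hg)
      simp only [ho, Set.mem_ofPred_eq] at this
      by_cases h : Edge (ev y ∘ k)
      · exact (this.1 h).mono fun x hx => iff_of_true hx h
      · exact (Ultrafilter.eventually_not.2 (mt this.2 h)).mono fun x hx => iff_of_false hx h
    · have hx (x) : ev x ∘ k = ev y ∘ k := by
        ext1 j
        simp only [Function.comp]
        cases hkj : k j with
        | inl a => rfl
        | inr => exact (hk ⟨j, hkj⟩).elim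
      exact Eventually.of_forall fun x => by rw [hx]
  refine ⟨y, fun φ hφ => ?_⟩
  obtain ⟨m, i, ψ, hψ⟩ := exists_formula_fin (M := GenericHypergraph R) φ
  have hsame : ∀ᶠ x in (U : Filter (GenericHypergraph R)),
      SameAtomicType (ev x ∘ i) (ev y ∘ i) :=
    (eventually_all.2 fun k => eventually_all.2 fun l => heq (i k) (i l)).and
      (eventually_all.2 fun k => hedge (i ∘ k))
  obtain ⟨x, hx, hxy⟩ := ((hU' φ hφ).and hsame).exists
  exact (hψ _).2 ((hxy.formula_realize_iff ψ).1 ((hψ _).1 hx))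

end GenericHypergraph

end Hypergraph

/-! ### The Ramsey property from the modelling property -/

section Ramsey

theorem exists_infinite_modelType_completeTheory (L : FirstOrder.Language.{u, v}) (M : Type w)
    [L.Structure M] [Infinite M] :
    ∃ K : Theory.ModelType.{u, v, max u v} (L.completeTheory M), Infinite K := by
  obtain ⟨K⟩ := completeTheory.isSatisfiable L M
  have : K ⊨ L.infiniteTheory := Theory.Model.mono K.is_model Theory.completeTheory.subset
  exact ⟨K, (model_infiniteTheory_iff L).1 this⟩

variable {L' : FirstOrder.Language.{u', v'}} {N : Type w} [L'.Structure N] [Infinite N] {n : ℕ}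

instance {W : Type x} [Infinite W] {R : Set (Fin n → W)} : Infinite (GenericHypergraph R) :=
  Infinite.of_injective GenericHypergraph.base fun _ _ => GenericHypergraph.base.inj

theorem isMonster_genericHypergraph (R : Set (Fin n → ULift.{max u v} N)) :
    IsMonster N ((hypergraphLanguage.{u, v} n).completeTheory (GenericHypergraph R))
      (GenericHypergraph R) (Order.succ (Cardinal.mk (ULift.{max u v} N))) where
  models := inferInstance
  card_language_lt := by
    refine Order.lt_succ_iff.2 (le_trans ?_ (Cardinal.aleph0_le_mk _))
    exact Cardinal.lift_le_aleph0.2 (card_hypergraphLanguage_le n)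
  card_index_lt := by
    rw [Cardinal.mk_uLift]
    exact Order.lt_succ _
  saturated := GenericHypergraph.isSaturated
  homogeneous := GenericHypergraph.isHomogeneous

open GenericHypergraph in
/-- For a finite `A`, the modelling property makes every colouring of the copies of `A` in `N`
homogeneous on a copy of `B`: it is applied to the hypergraph whose edges are the coloured copies
of `A`, inside a saturated hypergraph. -/
theorem HasFiniteMP.exists_homogeneous (h : HasFiniteMP.{u, v} L' N) {A : Type x} {B : Type y}
    [L'.Structure A] [L'.Structure B] [Finite A] [Finite B] (e₀ : B ↪[L'] N)
    (col : (A ↪[L'] N) → Prop) :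
    ∃ f : B ↪[L'] N, ∀ g h : A ↪[L'] B, col (f.comp g) ↔ col (f.comp h) := by
  obtain ⟨n, ⟨α⟩⟩ := Finite.exists_equiv_fin A
  obtain ⟨m, ⟨β⟩⟩ := Finite.exists_equiv_fin B
  let R : Set (Fin n → ULift.{max u v} N) :=
    {s | ∃ e : A ↪[L'] N, col e ∧ s = fun k => ULift.up (e (α.symm k))}
  let a (s : N) (_ : Fin 1) : GenericHypergraph R := base ⟨s⟩
  have hR (e : A ↪[L'] N) : Edge (fun k => a (e (α.symm k)) 0) ↔ col e := by
    refine (edge_base (R := R) _).trans ⟨fun ⟨e', he', h⟩ => ?_, fun he => ⟨e, he, rfl⟩⟩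
    have : e = e' := by
      ext p
      simpa using congrArg ULift.down (congrFun h (α p))
    rwa [this]
  obtain ⟨b, hb, hba⟩ := h _ _ (completeTheory.isComplete _ _)
    (exists_infinite_modelType_completeTheory _ _) _ _ (isMonster_genericHypergraph R) 1 a
  let edge (k : Fin n → Fin m) : (hypergraphLanguage.{u, v} n).Formula (Fin m × Fin 1) :=
    (edgeSymbol n).formula fun j => Term.var (k j, 0)
  have hedge (k : Fin n → Fin m) (c : Fin m × Fin 1 → GenericHypergraph R) :
      (edge k).Realize c ↔ Edge fun j => c (k j, 0) := by
    simp only [edge, Formula.realize_rel, relMap_edgeSymbol, Term.realize_var]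
  obtain ⟨j, hj, hjΔ⟩ := hba m (Set.range edge) (Set.finite_range _) fun k => e₀ (β.symm k)
  obtain ⟨f, hf⟩ := exists_embedding_of_qftp_eq (i := β.symm) (j := j)
    ((qftp_comp_embedding e₀ _).symm.trans hj) (by simp)
  refine ⟨f, fun g h => ?_⟩
  have key (g : A ↪[L'] B) :
      col (f.comp g) ↔ Edge fun k => b (e₀ (g (α.symm k))) 0 := by
    have := deltaTp_eq_iff.1 hjΔ _ ⟨fun k => β (g (α.symm k)), rfl⟩
    simp only [hedge, ← hf, Function.comp, Equiv.symm_apply_apply] at this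
    rw [this, ← hR]
    rfl
  have hgh := hb n (fun k => e₀ (g (α.symm k))) (fun k => e₀ (h (α.symm k)))
    ((qftp_comp_embedding (e₀.comp g) α.symm).trans
      (qftp_comp_embedding (e₀.comp h) α.symm).symm)
  have := Set.ext_iff.1 hgh ((edgeSymbol n).formula fun k => Term.var (k, 0))
  simp only [tp, Set.mem_ofPred_eq, Formula.realize_rel, relMap_edgeSymbol, Term.realize_var] at this
  rw [key, key, this]

/-- If the Ramsey property failed for `A` and `B`, then an ultrafilter limit of bad colourings of the
finitely generated substructures of `N` would be a bad colouring of `N`. -/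
theorem HasFiniteMP.hasERP (h : HasFiniteMP.{u, v} L' N) (hN : IsLocallyFinite L' N) :
    HasERP (L'.age N) := by
  classical
  intro A hA B hB _
  by_contra! hno
  have hbad (S : Finset N) : ∃ χ : (A ↪[L'] Substructure.closure L' (S : Set N)) → Fin 2,
      ∀ f : B ↪[L'] Substructure.closure L' (S : Set N),
        ∃ g h : A ↪[L'] B, χ (f.comp g) ≠ χ (f.comp h) := by
    simpa [Arrows] using hno ⟨Substructure.closure L' (S : Set N), inferInstance⟩
      (age.fg_substructure (Substructure.fg_closure S.finite_toSet))
  choose χ hχ using hbad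
  have := hN.finite_of_mem_age hA
  have := hN.finite_of_mem_age hB
  let U : Ultrafilter (Finset N) := Ultrafilter.of atTop
  let ext (S : Finset N) (e : A ↪[L'] N) : Prop :=
    ∃ g, (Substructure.closure L' (S : Set N)).subtype.comp g = e ∧ χ S g = 1
  have hext (S : Finset N) (g : A ↪[L'] Substructure.closure L' (S : Set N)) :
      ext S ((Substructure.closure L' (S : Set N)).subtype.comp g) ↔ χ S g = 1 := by
    refine ⟨fun ⟨g', hg', h⟩ => ?_, fun h => ⟨g, rfl, h⟩⟩
    have : g = g' := by
      ext p
      exact congrArg (fun e : A ↪[L'] N => e p) hg'.symm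
    rwa [this]
  obtain ⟨f, hf⟩ := h.exists_homogeneous hB.2.some
    fun e : A ↪[L'] N => ∀ᶠ S in (U : Filter (Finset N)), ext S e
  have : Finite (A ↪[L'] B) := DFunLike.finite _
  have h₁ : ∀ᶠ S in (U : Filter (Finset N)), ∀ g : A ↪[L'] B,
      (ext S (f.comp g) ↔ ∀ᶠ S in (U : Filter (Finset N)), ext S (f.comp g)) := by
    refine eventually_all.2 fun g => ?_
    by_cases hg : ∀ᶠ S in (U : Filter (Finset N)), ext S (f.comp g)
    · exact hg.mono fun S hS => iff_of_true hS hg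
    · exact (Ultrafilter.eventually_not.2 hg).mono fun S hS => iff_of_false hS hg
  have h₂ : ∀ᶠ S in (U : Filter (Finset N)), (Set.finite_range f).toFinset ≤ S :=
    Ultrafilter.of_le atTop (eventually_ge_atTop _)
  obtain ⟨S, hS₁, hS₂⟩ := (h₁.and h₂).exists
  let f' : B ↪[L'] Substructure.closure L' (S : Set N) :=
    Embedding.codRestrict _ f fun p => Substructure.subset_closure (hS₂ (by simp))
  obtain ⟨g, h, hgh⟩ := hχ S f'
  have hone (g : A ↪[L'] B) : χ S (f'.comp g) = 1 ↔ ext S (f.comp g) := (hext S _).symm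
  have : χ S (f'.comp g) = 1 ↔ χ S (f'.comp h) = 1 := by
    rw [hone, hone, hS₁, hS₁]
    exact hf g h
  omega

end Ramsey

end GenIndisc

theorem theorem6 (L' : FirstOrder.Language.{u', v'}) (N : Type w) [L'.Structure N] [Infinite N]
    (hN : GenIndisc.IsLocallyFinite L' N) :
    List.TFAE [
      GenIndisc.IsRamseyClass (L'.age N),
      GenIndisc.HasERP (L'.age N),
      GenIndisc.HasMP.{u, v} L' N,
      GenIndisc.HasFiniteMP.{u, v} L' N] := by
  tfae_have 1 ↔ 2 := GenIndisc.isRamseyClass_age_iff hN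
  tfae_have 2 → 3 := fun h _ _ _ _ _ _ _ hM _ hα =>
    h.modelsSequences hM.saturated hM.card_index_lt hα
  tfae_have 3 → 4 := GenIndisc.HasMP.hasFiniteMP
  tfae_have 4 → 2 := fun h => h.hasERP hN
  tfae_finish
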